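/- Let $M$ be a simply connected smooth ($C^\infty$, Hausdorff, second countable) manifold and let $X_1,\dots,X_q$ be smooth vector fields on $M$ generating a Lie algebra $\mathfrak g=\mathrm{Lie}(X_1,\dots,X_q)$ such that (1) $\mathfrak g$ is finite dimensional, (2) every $X\in\mathfrak g$ is complete, (3) $\{X_x : X\in\mathfrak g\}=T_xM$ for every $x\in M$. Let $G$ be the connected and simply connected Lie group with an isomorphism $L\colon \mathrm{Lie}(G)\to\mathfrak g$, and let $\mu\colon M\times G\to M$, $(x,g)\mapsto x\cdot g$, be the smooth right action whose infinitesimal generator is $L$, i.e. $\mathrm d_e\mu(x,\cdot)\,v=(Lv)_x$ for all $x\in M$, $v\in \mathrm{Lie}(G)$. Let $H\subset G$ be a discrete subgroup such that, writing $R_h(x)=x\cdot h$, one has $\mathrm dR_hX=X$ for all $h\in H$ and $X\in\mathfrak g$. Then: (a) $H$ lies in the center of $G$ (in particular it is normal). (b) The elements of $G$ that act trivially on $M$ form a discrete subgroup contained in the center of $G$. (c) A central element of $G$ that fixes some point of $M$ acts trivially on $M$ (so, if the action is effective, nontrivial central elements, in particular nontrivial elements of $H$, have no fixed point). (d) The action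 of $G$ on $M$ induces a right action of $G/H$ on $N=M/H$, given by $[x]\cdot gH=[x\cdot g]$. It is continuous for the quotient topologies, and it is smooth whenever $N=M/H$ is a smooth manifold for which the projection $M\to N$ is a local diffeomorphism (as when $M$ is the universal cover of $N$). -/

import Mathlib

open scoped Manifold ContDiff Topology
open VectorField

/-- Smooth vector fields on a smooth manifold modelled on `ℝᵐ`: smooth sections of the
tangent bundle. -/
abbrev VecField (m : ℕ) (M : Type*) [TopologicalSpace M]
    [ChartedSpace (EuclideanSpace ℝ (Fin m)) M] [IsManifold (𝓡 m) ∞ M] : Type _ :=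
  ContMDiffSection (𝓡 m) (EuclideanSpace ℝ (Fin m)) ∞ (TangentSpace (𝓡 m) : M → Type _)

namespace VecField

variable {m : ℕ} {M : Type*} [TopologicalSpace M]
  [ChartedSpace (EuclideanSpace ℝ (Fin m)) M] [IsManifold (𝓡 m) ∞ M]

theorem mdiff (X : VecField m M) (x : M) :
    MDifferentiableAt (𝓡 m) ((𝓡 m).prod 𝓘(ℝ, EuclideanSpace ℝ (Fin m)))
      (fun y => (⟨y, X y⟩ : TangentBundle (𝓡 m) M)) x :=
  (X.contMDiff x).mdifferentiableAt (by simp)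

theorem contMDiff_bracket (X Y : VecField m M) :
    ContMDiff (𝓡 m) ((𝓡 m).prod 𝓘(ℝ, EuclideanSpace ℝ (Fin m))) ∞
      (fun y => (⟨y, mlieBracket (𝓡 m) X Y y⟩ : TangentBundle (𝓡 m) M)) := by
  have : IsManifold (𝓡 m) (((⊤ : ℕ∞) : WithTop ℕ∞) + 1) M := by
    have h : (((⊤ : ℕ∞) : WithTop ℕ∞) + 1) = ∞ := rfl
    rw [h]; infer_instance
  have : IsManifold (𝓡 m) (minSmoothness ℝ 2) M := by
    rw [minSmoothness_of_isRCLikeNormedField]; infer_instance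
  refine ContDiff.mlieBracket_vectorField (m := ⊤) (n := ⊤) X.contMDiff Y.contMDiff ?_
  rw [minSmoothness_of_isRCLikeNormedField]
  exact le_of_eq rfl

/-- The Lie bracket of vector fields. -/
noncomputable instance : Bracket (VecField m M) (VecField m M) where
  bracket X Y := ⟨mlieBracket (𝓡 m) X Y, contMDiff_bracket X Y⟩

theorem bracket_apply (X Y : VecField m M) (x : M) :
    ⁅X, Y⁆ x = mlieBracket (𝓡 m) X Y x := rfl

theorem coe_bracket (X Y : VecField m M) :
    (⁅X, Y⁆ : VecField m M) = mlieBracket (𝓡 m) (X : ∀ x, TangentSpace (𝓡 m) x) Y := rfl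

noncomputable instance : LieRing (VecField m M) where
  add_lie X Y Z := by
    ext1 x
    exact mlieBracket_add_left (X.mdiff x) (Y.mdiff x)
  lie_add X Y Z := by
    ext1 x
    exact mlieBracket_add_right (Y.mdiff x) (Z.mdiff x)
  lie_self X := by
    ext1 x
    rw [bracket_apply, mlieBracket_self]; rfl
  leibniz_lie X Y Z := by
    have : IsManifold (𝓡 m) (minSmoothness ℝ 3) M := by
      rw [minSmoothness_of_isRCLikeNormedField]; infer_instance
    have hs : ∀ W : VecField m M,
        ContMDiff (𝓡 m) ((𝓡 m).prod 𝓘(ℝ, EuclideanSpace ℝ (Fin m))) (minSmoothness ℝ 2)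
          (fun y => (⟨y, W y⟩ : TangentBundle (𝓡 m) M)) := by
      intro W
      rw [minSmoothness_of_isRCLikeNormedField]
      exact W.contMDiff.of_le (ENat.LEInfty.out)
    apply ContMDiffSection.coe_injective
    exact leibniz_identity_mlieBracket (hs X) (hs Y) (hs Z)

noncomputable instance : LieAlgebra ℝ (VecField m M) where
  lie_smul c X Y := by
    ext1 x
    exact mlieBracket_const_smul_right (Y.mdiff x)

end VecField

/-- A smooth Lie group has the (finite) smoothness over which its Lie algebra is defined. -/
instance {n : ℕ} {G : Type*} [TopologicalSpace G] [ChartedSpace (EuclideanSpace ℝ (Fin n)) G]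
    [Group G] [LieGroup (𝓡 n) ∞ G] : LieGroup (𝓡 n) (minSmoothness ℝ 3) G := by
  rw [minSmoothness_of_isRCLikeNormedField]; infer_instance

section

variable {m : ℕ} {M : Type*} [TopologicalSpace M]
  [ChartedSpace (EuclideanSpace ℝ (Fin m)) M] [IsManifold (𝓡 m) ∞ M]

/-- Standing conditions on a Lie algebra of smooth vector fields: it is finite dimensional,
consists of complete fields, and spans the tangent space at every point. -/
structure IsCompleteHormander (g : LieSubalgebra ℝ (VecField m M)) : Prop where
  finiteDimensional : FiniteDimensional ℝ g
  complete : ∀ X ∈ g, ∀ x : M, ∃ γ : ℝ → M, γ 0 = x ∧ IsMIntegralCurve γ X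
  spans : ∀ (x : M) (v : TangentSpace (𝓡 m) x), ∃ X ∈ g, X x = v

/-- A right action of a group on a set. -/
structure IsRightAction {A G : Type*} [Group G] (μ : A → G → A) : Prop where
  one : ∀ x, μ x 1 = x
  mul : ∀ x a b, μ x (a * b) = μ (μ x a) b

/-- `μ` is a smooth right action of the Lie group `G` on `M` whose infinitesimal generator,
`v ↦ (x ↦ d(μ(x, ·))ₑ v)`, is the map `L` from the Lie algebra of `G` onto `g`.
(The generator is evaluated at `μ x 1`, which is `x`.) -/
structure IsActionGeneratedBy {n : ℕ} {G : Type*} [TopologicalSpace G]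
    [ChartedSpace (EuclideanSpace ℝ (Fin n)) G] [Group G] [LieGroup (𝓡 n) ∞ G]
    {g : LieSubalgebra ℝ (VecField m M)} (L : GroupLieAlgebra (𝓡 n) G ≃ₗ⁅ℝ⁆ g)
    (μ : M → G → M) : Prop where
  isRightAction : IsRightAction μ
  contMDiff : ContMDiff ((𝓡 m).prod (𝓡 n)) (𝓡 m) ∞ (fun p : M × G => μ p.1 p.2)
  generator : ∀ (v : GroupLieAlgebra (𝓡 n) G) (x : M),
    mfderiv (𝓡 n) (𝓡 m) (μ x) 1 v = (L v : VecField m M) (μ x 1)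

end

/-- `pr : M → N` exhibits the space `N` as the orbit space `M/H` for the restriction to the
subgroup `H` of the right action `μ`, with the quotient topology. -/
structure IsOrbitQuotient {M G N : Type*} [TopologicalSpace M] [TopologicalSpace N] [Group G]
    (μ : M → G → M) (H : Subgroup G) (pr : M → N) : Prop where
  isQuotientMap : Topology.IsQuotientMap pr
  fibers : ∀ x y, pr x = pr y ↔ ∃ h ∈ H, y = μ x h

/-!
Why the theorem holds.

Write `R_c` for the map `x ↦ μ x c`. Since `R_c ∘ μ y' = μ y ∘ φ` with `y' = μ y c⁻¹` and
`φ a = c⁻¹ a c`, differentiating at `1` turns the invariance `dR_c Y = Y` of all fields `Y ∈ g` into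
`L (dφ v) = L v`, so that `dφ = id` at `1` because `L` is injective. A smooth homomorphism of a
connected Lie group with this derivative is the identity: `a ↦ φ a / a` has zero derivative at `1`,
hence, by translation, everywhere, so it is constant. This gives that `c` is central
(`IsActionGeneratedBy.mem_center_of_preserves`), and it applies both to the elements of `H` and to
the elements acting trivially, for which `R_c` is the identity. No exponential map is needed.

The kernel of the action is discrete because, `g` being finite dimensional, finitely many points
`x₁, …, x_k` suffice to detect that an element of the Lie algebra vanishes; then
`c ↦ (μ x₁ c, …, μ x_k c)` has injective derivative at `1` and does not take its value at `1` at
other points near `1` (`IsActionGeneratedBy.eventually_eq_one_of_acts_trivially`).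

The orbit maps are submersions at `1` because `g` spans the tangent spaces, so orbits are open and,
`M` being connected, the action is transitive (`IsActionGeneratedBy.exists_apply_eq`). A central
element fixing one point of a transitive action fixes them all.

Finally `pr × mk : M × G → N × G/H` is an open quotient map, and a local diffeomorphism if `pr` and
`mk` are; continuity and smoothness of the induced action descend along it from `pr ∘ μ`.
-/

/-! ### Maps between manifolds and their derivatives -/

section Manifold

variable {m n : ℕ} {M N : Type*}
  [TopologicalSpace M] [ChartedSpace (EuclideanSpace ℝ (Fin m)) M]
  [TopologicalSpace N] [ChartedSpace (EuclideanSpace ℝ (Fin n)) N]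

/-- A map with zero derivative everywhere on a connected manifold without boundary is constant. -/
theorem eq_of_hasMFDerivAt_zero [IsManifold (𝓡 m) 1 M] [IsManifold (𝓡 n) 1 N]
    [PreconnectedSpace M] {f : M → N} (hf : ∀ x, HasMFDerivAt (𝓡 m) (𝓡 n) f x 0) (x y : M) :
    f x = f y := by
  refine IsLocallyConstant.apply_eq_of_preconnectedSpace
    ((IsLocallyConstant.iff_eventually_eq f).2 fun x => ?_) x y
  set e := extChartAt (𝓡 m) x
  set e' := extChartAt (𝓡 n) (f x)
  have hcont : ContinuousAt (f ∘ e.symm) (e x) := by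
    refine ContinuousAt.comp ?_ (continuousAt_extChartAt_symm x)
    exact (hf _).continuousAt
  have hx0 : (f ∘ e.symm) (e x) = f x := congrArg f (extChartAt_to_inv x)
  have h1 : ∀ᶠ z in 𝓝 (e x), z ∈ e.target ∧ (f ∘ e.symm) z ∈ e'.source :=
    Filter.Eventually.and ((isOpen_extChartAt_target x).mem_nhds (mem_extChartAt_target x))
      (hcont.eventually ((isOpen_extChartAt_source (f x)).mem_nhds
        (by rw [hx0]; exact mem_extChartAt_source (f x))))
  obtain ⟨r, hr, hball⟩ := Metric.eventually_nhds_iff_ball.1 h1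
  have hd : ∀ z ∈ Metric.ball (e x) r, HasFDerivAt (e' ∘ f ∘ e.symm)
      (0 : EuclideanSpace ℝ (Fin m) →L[ℝ] EuclideanSpace ℝ (Fin n)) z := by
    intro z hz
    obtain ⟨hz1, hz2⟩ := hball z hz
    have hs : MDifferentiableAt 𝓘(ℝ, EuclideanSpace ℝ (Fin m)) (𝓡 m) e.symm z :=
      ((contMDiffOn_extChartAt_symm (n := 1) x).contMDiffAt
        ((isOpen_extChartAt_target x).mem_nhds hz1)).mdifferentiableAt one_ne_zero
    have he : MDifferentiableAt (𝓡 n) 𝓘(ℝ, EuclideanSpace ℝ (Fin n)) e' (f (e.symm z)) :=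
      mdifferentiableAt_extChartAt (by rwa [← extChartAt_source (𝓡 n)])
    have := he.hasMFDerivAt.comp z ((hf (e.symm z)).comp z hs.hasMFDerivAt)
    rw [ContinuousLinearMap.zero_comp, ContinuousLinearMap.comp_zero] at this
    exact hasMFDerivAt_iff_hasFDerivAt.1 this
  have hconst : ∀ z ∈ Metric.ball (e x) r, (e' ∘ f ∘ e.symm) z = (e' ∘ f ∘ e.symm) (e x) :=
    fun z hz => Metric.isOpen_ball.is_const_of_fderiv_eq_zero (𝕜 := ℝ)
      (convex_ball _ _).isPreconnected
      (fun w hw => (hd w hw).differentiableAt.differentiableWithinAt)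
      (fun w hw => (hd w hw).fderiv) hz (Metric.mem_ball_self hr)
  filter_upwards [(continuousAt_extChartAt (I := 𝓡 m) x).preimage_mem_nhds
    (Metric.ball_mem_nhds _ hr), extChartAt_source_mem_nhds (I := 𝓡 m) x] with y hy hys
  have h2 := hconst _ hy
  have h3 := (hball _ hy).2
  simp only [Function.comp_apply] at h2 h3
  rw [e.left_inv hys] at h2 h3
  rw [show e.symm (e x) = x from extChartAt_to_inv x] at h2
  exact e'.injOn h3 (mem_extChartAt_source (f x)) h2

/-- On manifolds without boundary the derivative is that of the chart expression on a full
neighbourhood, which gives access to the calculus lemmas on `HasFDerivAt`. -/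
theorem hasFDerivAt_writtenInExtChartAt {f : M → N} {x : M}
    (hf : MDifferentiableAt (𝓡 m) (𝓡 n) f x) :
    HasFDerivAt (writtenInExtChartAt (𝓡 m) (𝓡 n) x f)
      (mfderiv (𝓡 m) (𝓡 n) f x : EuclideanSpace ℝ (Fin m) →L[ℝ] EuclideanSpace ℝ (Fin n))
      (extChartAt (𝓡 m) x x) := by
  have h := hf.hasMFDerivAt.2
  rw [ModelWithCorners.range_eq_univ] at h
  exact hasFDerivWithinAt_univ.1 h

/-- The range of a map that is a submersion at one point `x` is a neighbourhood of the image
of `x`. -/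
theorem range_mem_nhds_of_mfderiv_surjective {f : M → N} {x : M}
    (hf : ContMDiffAt (𝓡 m) (𝓡 n) 1 f x)
    (hs : Function.Surjective (mfderiv (𝓡 m) (𝓡 n) f x)) : Set.range f ∈ 𝓝 (f x) := by
  have hF := hasFDerivAt_writtenInExtChartAt (hf.mdifferentiableAt one_ne_zero)
  have hC := (contMDiffAt_iff.1 hf).2
  rw [ModelWithCorners.range_eq_univ, contDiffWithinAt_univ] at hC
  have hst : HasStrictFDerivAt (writtenInExtChartAt (𝓡 m) (𝓡 n) x f) _ _ :=
    hC.hasStrictFDerivAt' hF one_ne_zero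
  have hmap := hst.map_nhds_eq_of_surj (LinearMap.range_eq_top.2 hs)
  have hFx : writtenInExtChartAt (𝓡 m) (𝓡 n) x f (extChartAt (𝓡 m) x x)
      = extChartAt (𝓡 n) (f x) (f x) := by
    simp [writtenInExtChartAt]
  have hcont : ContinuousAt (f ∘ (extChartAt (𝓡 m) x).symm) (extChartAt (𝓡 m) x x) := by
    refine ContinuousAt.comp ?_ (continuousAt_extChartAt_symm x)
    rw [extChartAt_to_inv]
    exact hf.continuousAt
  have hsrc : ∀ᶠ z in 𝓝 (extChartAt (𝓡 m) x x),
      (f ∘ (extChartAt (𝓡 m) x).symm) z ∈ (extChartAt (𝓡 n) (f x)).source :=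
    hcont.eventually ((isOpen_extChartAt_source (f x)).mem_nhds
        (by simp))
  have himg := Filter.image_mem_map (m := writtenInExtChartAt (𝓡 m) (𝓡 n) x f) hsrc
  rw [hmap, hFx] at himg
  filter_upwards [(continuousAt_extChartAt (I := 𝓡 n) (f x)).preimage_mem_nhds himg,
    extChartAt_source_mem_nhds (I := 𝓡 n) (f x)] with y hy hys
  obtain ⟨z, hz, hzy⟩ := hy
  exact ⟨_, (extChartAt (𝓡 n) (f x)).injOn hz hys hzy⟩

end Manifold

/-! ### Central elements of a connected Lie group -/

section LieGroup

variable {n : ℕ} {G : Type*} [TopologicalSpace G] [ChartedSpace (EuclideanSpace ℝ (Fin n)) G]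
  [Group G] [LieGroup (𝓡 n) ∞ G]

/-- In a connected Lie group an element `c` with `Ad (c⁻¹) = id` is central: the map
`a ↦ (c⁻¹ a c) a⁻¹` has zero derivative. -/
theorem mem_center_of_hasMFDerivAt_conj [PreconnectedSpace G] {c : G}
    (hc : HasMFDerivAt (𝓡 n) (𝓡 n) (fun a : G => c⁻¹ * a * c) 1
      (ContinuousLinearMap.id ℝ (EuclideanSpace ℝ (Fin n)))) : c ∈ Subgroup.center G := by
  have : IsManifold (𝓡 n) 1 G := IsManifold.of_le (n := ∞) (by simp)
  -- As `a ↦ c⁻¹ a c` has the derivative of the identity at `1`, the map has the same derivative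
  -- there as the constant map `a ↦ a / a`.
  have hF : HasMFDerivAt (𝓡 n) (𝓡 n) (fun a : G => c⁻¹ * a * c / a) 1 0 := by
    have hD : MDifferentiableAt ((𝓡 n).prod (𝓡 n)) (𝓡 n) (fun p : G × G => p.1 / p.2)
        ((1 : G), (1 : G)) :=
      ((contMDiff_fst (n := ∞)).div contMDiff_snd).mdifferentiable (by simp) _
    have hid := hasMFDerivAt_id (I := 𝓡 n) (1 : G)
    have h1 := HasMFDerivAt.comp (1 : G) (f := fun a : G => (a, a))
      (g := fun p : G × G => p.1 / p.2) hD.hasMFDerivAt (hid.prodMk hid)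
    have h0 : HasMFDerivAt (𝓡 n) (𝓡 n) (fun a : G => a / a) 1 0 := by
      rw [show (fun a : G => a / a) = fun _ => 1 from funext div_self']
      exact hasMFDerivAt_const (1 : G) (1 : G)
    have h10 := hasMFDerivAt_unique h1 h0
    have h2 := HasMFDerivAt.comp (1 : G) (f := fun a : G => (c⁻¹ * a * c, a))
      (g := fun p : G × G => p.1 / p.2)
      (g' := mfderiv ((𝓡 n).prod (𝓡 n)) (𝓡 n) (fun p : G × G => p.1 / p.2) ((1 : G), (1 : G)))
      (by rw [mul_one, inv_mul_cancel]; exact hD.hasMFDerivAt) (hc.prodMk hid)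
    exact h2.congr_mfderiv h10
  -- Translation to `g`: with `φ a = c⁻¹ a c`, one has `φ a / a = φ g (φ (g⁻¹ a) / (g⁻¹ a)) g⁻¹`.
  have hz : ∀ g : G, HasMFDerivAt (𝓡 n) (𝓡 n) (fun a : G => c⁻¹ * a * c / a) g 0 := by
    intro g
    have hl : MDifferentiableAt (𝓡 n) (𝓡 n) (fun a : G => g⁻¹ * a) g :=
      (contMDiff_mul_left (n := ∞)).mdifferentiable (by simp) g
    have ho : MDifferentiableAt (𝓡 n) (𝓡 n) (fun a : G => c⁻¹ * g * c * a * g⁻¹)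
        (c⁻¹ * (g⁻¹ * g) * c / (g⁻¹ * g)) :=
      ((contMDiff_mul_right (n := ∞)).comp (contMDiff_mul_left (n := ∞))).mdifferentiable
        (by simp) _
    have hF' : HasMFDerivAt (𝓡 n) (𝓡 n) (fun a : G => c⁻¹ * a * c / a) (g⁻¹ * g) 0 := by
      rw [inv_mul_cancel]; exact hF
    have := ho.hasMFDerivAt.comp g (hF'.comp g hl.hasMFDerivAt)
    rw [ContinuousLinearMap.zero_comp, ContinuousLinearMap.comp_zero] at this
    have hfun : (fun a : G => c⁻¹ * a * c / a) = (fun a : G => c⁻¹ * g * c * a * g⁻¹) ∘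
        (fun a : G => c⁻¹ * a * c / a) ∘ fun a : G => g⁻¹ * a := by
      funext a
      simp only [Function.comp_apply, div_eq_mul_inv]
      group
    rw [hfun]
    exact this
  refine Subgroup.mem_center_iff.2 fun g => ?_
  have h := eq_of_hasMFDerivAt_zero hz g 1
  simp only [mul_one, inv_mul_cancel, div_one, div_eq_one] at h
  calc g * c = c * (c⁻¹ * g * c) := by group
    _ = c * g := by rw [h]

end LieGroup

/-! ### The infinitesimal generator of an action -/

/-- On a finite-dimensional space, a point-separating family of linear maps has a finite
point-separating subfamily. -/
theorem exists_finset_forall_apply_eq_zero {ι V : Type*} [AddCommGroup V] [Module ℝ V]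
    [FiniteDimensional ℝ V] {W : ι → Type*} [∀ i, AddCommGroup (W i)] [∀ i, Module ℝ (W i)]
    (f : ∀ i, V →ₗ[ℝ] W i) (hf : ∀ v, (∀ i, f i v = 0) → v = 0) :
    ∃ s : Finset ι, ∀ v, (∀ i ∈ s, f i v = 0) → v = 0 := by
  classical
  obtain ⟨_, ⟨s, rfl⟩, hs⟩ := wellFounded_lt.has_min
    (Set.range fun s : Finset ι => ⨅ i ∈ s, LinearMap.ker (f i)) (Set.range_nonempty _)
  refine ⟨s, fun v hv => hf v fun i => ?_⟩
  have hle : (⨅ j ∈ insert i s, LinearMap.ker (f j)) ≤ ⨅ j ∈ s, LinearMap.ker (f j) :=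
    biInf_mono fun _ => Finset.mem_insert_of_mem
  have heq := hle.eq_of_not_lt (hs _ ⟨insert i s, rfl⟩)
  have hmem : v ∈ ⨅ j ∈ s, LinearMap.ker (f j) := by simpa [Submodule.mem_iInf] using hv
  rw [← heq] at hmem
  simp only [Submodule.mem_iInf, LinearMap.mem_ker] at hmem
  exact hmem i (Finset.mem_insert_self i s)

section Action

variable {m n : ℕ} {M : Type*} [TopologicalSpace M]
  [ChartedSpace (EuclideanSpace ℝ (Fin m)) M] [IsManifold (𝓡 m) ∞ M]
  {g : LieSubalgebra ℝ (VecField m M)}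
  {G : Type*} [TopologicalSpace G] [ChartedSpace (EuclideanSpace ℝ (Fin n)) G] [Group G]
  [LieGroup (𝓡 n) ∞ G] {L : GroupLieAlgebra (𝓡 n) G ≃ₗ⁅ℝ⁆ g} {μ : M → G → M}

namespace IsActionGeneratedBy

theorem contMDiff_orbit (hμ : IsActionGeneratedBy L μ) (x : M) :
    ContMDiff (𝓡 n) (𝓡 m) ∞ (μ x) :=
  hμ.contMDiff.comp (contMDiff_const.prodMk contMDiff_id)

theorem contMDiff_right (hμ : IsActionGeneratedBy L μ) (c : G) :
    ContMDiff (𝓡 m) (𝓡 m) ∞ (fun x => μ x c) :=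
  hμ.contMDiff.comp (contMDiff_id.prodMk contMDiff_const)

/-- An element of the Lie algebra is determined by the derivatives of the orbit maps, as these give
the values of its image under the injective map `L`. -/
theorem eq_of_forall_mfderiv_eq (hμ : IsActionGeneratedBy L μ) {v w : GroupLieAlgebra (𝓡 n) G}
    (h : ∀ x, mfderiv (𝓡 n) (𝓡 m) (μ x) 1 v = mfderiv (𝓡 n) (𝓡 m) (μ x) 1 w) : v = w := by
  apply L.injective
  apply Subtype.ext
  apply ContMDiffSection.ext
  intro x
  have h1 := (hμ.generator v x).symm.trans ((h x).trans (hμ.generator w x))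
  rwa [hμ.isRightAction.one] at h1

/-- An element whose action preserves every vector field of `g` is central. -/
theorem mem_center_of_preserves [PreconnectedSpace G] (hμ : IsActionGeneratedBy L μ) {c : G}
    (hc : ∀ Y ∈ g, ∀ x : M, mfderiv (𝓡 m) (𝓡 m) (fun y => μ y c) x (Y x) = Y (μ x c)) :
    c ∈ Subgroup.center G := by
  apply mem_center_of_hasMFDerivAt_conj (n := n)
  have hφ : MDifferentiableAt (𝓡 n) (𝓡 n) (fun a : G => c⁻¹ * a * c) 1 :=
    ((contMDiff_mul_right (n := ∞)).comp (contMDiff_mul_left (n := ∞))).mdifferentiable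
      (by simp) _
  suffices hv : ∀ v : GroupLieAlgebra (𝓡 n) G,
      mfderiv (𝓡 n) (𝓡 n) (fun a : G => c⁻¹ * a * c) 1 v = v from
    hφ.hasMFDerivAt.congr_mfderiv (ContinuousLinearMap.ext hv)
  intro v
  refine hμ.eq_of_forall_mfderiv_eq fun y => ?_
  -- Differentiate `μ (μ y' a) c = μ y (c⁻¹ a c)`, where `y' = μ y c⁻¹`, at `a = 1` in two ways.
  have hone : c⁻¹ * 1 * c = 1 := by group
  have hcomp : (fun z => μ z c) ∘ μ (μ y c⁻¹) = μ y ∘ fun a => c⁻¹ * a * c := by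
    funext a
    simp only [Function.comp_apply, hμ.isRightAction.mul]
  have hy : μ (μ (μ y c⁻¹) 1) c = μ y 1 := by
    rw [← hμ.isRightAction.mul, ← hμ.isRightAction.mul]; simp
  have hl := HasMFDerivAt.comp (1 : G) (g := μ y) (f := fun a : G => c⁻¹ * a * c)
    (g' := mfderiv (𝓡 n) (𝓡 m) (μ y) 1)
    (by rw [hone]; exact ((hμ.contMDiff_orbit y).mdifferentiable (by simp) _).hasMFDerivAt)
    hφ.hasMFDerivAt
  have hr := HasMFDerivAt.comp (1 : G) (g := fun z => μ z c) (f := μ (μ y c⁻¹))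
    (((hμ.contMDiff_right c).mdifferentiable (by simp) _).hasMFDerivAt)
    ((hμ.contMDiff_orbit (μ y c⁻¹)).mdifferentiable (by simp) _).hasMFDerivAt
  rw [hcomp] at hr
  have key := congrArg (fun T : EuclideanSpace ℝ (Fin n) →L[ℝ] EuclideanSpace ℝ (Fin m) => T v)
    (hasMFDerivAt_unique hl hr)
  refine Eq.trans key ?_
  change mfderiv (𝓡 m) (𝓡 m) (fun z => μ z c) (μ (μ y c⁻¹) 1)
    (mfderiv (𝓡 n) (𝓡 m) (μ (μ y c⁻¹)) 1 v) = _
  rw [hμ.generator, hμ.generator, hc _ (L v).2, hy]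

theorem mem_center_of_acts_trivially [PreconnectedSpace G] (hμ : IsActionGeneratedBy L μ) {c : G}
    (hc : ∀ x, μ x c = x) : c ∈ Subgroup.center G := by
  refine hμ.mem_center_of_preserves fun Y _ x => ?_
  have : (fun y => μ y c) = id := funext hc
  rw [hc, this, mfderiv_id]
  rfl

/-- The kernel of the action is discrete: it meets some neighbourhood of `1` only in `1`. -/
theorem eventually_eq_one_of_acts_trivially (hμ : IsActionGeneratedBy L μ) :
    ∀ᶠ c in 𝓝 (1 : G), (∀ x, μ x c = x) → c = 1 := by
  let T : M → EuclideanSpace ℝ (Fin n) →L[ℝ] EuclideanSpace ℝ (Fin m) :=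
    fun x => mfderiv (𝓡 n) (𝓡 m) (μ x) 1
  obtain ⟨s, hs⟩ := exists_finset_forall_apply_eq_zero (fun x => (T x).toLinearMap)
    (fun v hv => hμ.eq_of_forall_mfderiv_eq fun x => (hv x).trans (map_zero _).symm)
  have hF : HasFDerivAt (fun z (x : s) => writtenInExtChartAt (𝓡 n) (𝓡 m) 1 (μ x) z)
      (ContinuousLinearMap.pi fun x : s => T x)
      (extChartAt (𝓡 n) (1 : G) 1) :=
    hasFDerivAt_pi.2 fun x => hasFDerivAt_writtenInExtChartAt
      ((hμ.contMDiff_orbit x).mdifferentiable (by simp) _)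
  have hanti : ∃ C, AntilipschitzWith C (ContinuousLinearMap.pi fun x : s => T x) := by
    obtain ⟨C, -, hC⟩ := LinearMap.exists_antilipschitzWith
      (ContinuousLinearMap.pi fun x : s => T x).toLinearMap
      (LinearMap.ker_eq_bot'.2 fun v hv => hs v fun x hx => congrFun hv ⟨x, hx⟩)
    exact ⟨C, hC⟩
  have hne := hF.eventually_ne (c := fun x : s => extChartAt (𝓡 m) (μ x 1) (x : M)) hanti
  rw [eventually_nhdsWithin_iff] at hne
  filter_upwards [(continuousAt_extChartAt (I := 𝓡 n) (1 : G)).eventually hne,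
    extChartAt_source_mem_nhds (I := 𝓡 n) (1 : G)] with c hc hcs htriv
  by_contra h1
  refine hc (fun h => h1 ((extChartAt (𝓡 n) (1 : G)).injOn hcs (mem_extChartAt_source 1) h)) ?_
  funext x
  simp only [writtenInExtChartAt, Function.comp_apply]
  rw [(extChartAt (𝓡 n) (1 : G)).left_inv hcs, htriv]

/-- The action is transitive: its orbits are open because `g` spans every tangent space, hence
clopen. -/
theorem exists_apply_eq [PreconnectedSpace M] (hg : IsCompleteHormander g)
    (hμ : IsActionGeneratedBy L μ) (x y : M) : ∃ a, μ x a = y := by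
  have hnhds : ∀ z, Set.range (μ z) ∈ 𝓝 z := by
    intro z
    have h := range_mem_nhds_of_mfderiv_surjective (x := (1 : G))
      ((hμ.contMDiff_orbit z).contMDiffAt.of_le (by simp)) fun w => by
        obtain ⟨Y, hY, hYw⟩ := hg.spans _ w
        refine ⟨L.symm ⟨Y, hY⟩, (hμ.generator _ z).trans ?_⟩
        rw [L.apply_symm_apply]
        exact hYw
    rwa [hμ.isRightAction.one] at h
  have hsub : ∀ z w, w ∈ Set.range (μ z) → Set.range (μ w) ⊆ Set.range (μ z) := by
    rintro z _ ⟨a, rfl⟩ _ ⟨b, rfl⟩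
    exact ⟨a * b, hμ.isRightAction.mul z a b⟩
  have hsymm : ∀ z w, w ∈ Set.range (μ z) → z ∈ Set.range (μ w) := by
    rintro z _ ⟨a, rfl⟩
    exact ⟨a⁻¹, by rw [← hμ.isRightAction.mul, mul_inv_cancel, hμ.isRightAction.one]⟩
  have hclopen : IsClopen (Set.range (μ x)) := by
    refine ⟨⟨isOpen_iff_mem_nhds.2 fun z hz => ?_⟩, isOpen_iff_mem_nhds.2 fun z hz => ?_⟩
    · filter_upwards [hnhds z] with w hw hxw
      exact hz (hsub x w hxw (hsymm z w hw))
    · exact Filter.mem_of_superset (hnhds z) (hsub x z hz)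
  have huniv := hclopen.eq_univ (Set.range_nonempty _)
  exact huniv.ge (Set.mem_univ y)

end IsActionGeneratedBy

end Action

/-! ### Orbit spaces -/

section Quotient

theorem IsRightAction.apply_eq_of_mem_center {A G : Type*} [Group G] {μ : A → G → A}
    (hμ : IsRightAction μ) (htrans : ∀ x y, ∃ a, μ x a = y) {c : G}
    (hc : c ∈ Subgroup.center G) {x : A} (hx : μ x c = x) (y : A) : μ y c = y := by
  obtain ⟨a, rfl⟩ := htrans x y
  rw [← hμ.mul, Subgroup.mem_center_iff.1 hc a, hμ.mul, hx]

variable {M G N : Type*} [TopologicalSpace M] [TopologicalSpace N] [Group G]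
  {μ : M → G → M} {H : Subgroup G} {pr : M → N}

namespace IsOrbitQuotient

theorem isOpenQuotientMap (hpr : IsOrbitQuotient μ H pr)
    (hc : ∀ a, Continuous fun x => μ x a) : IsOpenQuotientMap pr := by
  refine .of_isOpenMap_isQuotientMap (fun U hU => ?_) hpr.isQuotientMap
  rw [← hpr.isQuotientMap.isOpen_preimage]
  have : pr ⁻¹' (pr '' U) = ⋃ h ∈ H, (fun x => μ x h) ⁻¹' U := by
    ext x
    simp only [Set.mem_preimage, Set.mem_image, Set.mem_iUnion, exists_prop]
    constructor
    · rintro ⟨y, hy, hyx⟩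
      obtain ⟨h, hh, rfl⟩ := (hpr.fibers x y).1 hyx.symm
      exact ⟨h, hh, hy⟩
    · rintro ⟨h, hh, hU⟩
      exact ⟨_, hU, ((hpr.fibers x _).2 ⟨h, hh, rfl⟩).symm⟩
  rw [this]
  exact isOpen_biUnion fun h _ => hU.preimage (hc h)

/-- When `H` is central, the action of `G` on `M` induces a map `N → G ⧸ H → N` on `N = M/H`. -/
theorem exists_induced (hpr : IsOrbitQuotient μ H pr) (hμ : IsRightAction μ)
    (hH : H ≤ Subgroup.center G) :
    ∃ ν : N → G ⧸ H → N, ∀ x (a : G), ν (pr x) (a : G ⧸ H) = pr (μ x a) := by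
  have hwd : ∀ x y : M, ∀ a b : G, pr x = pr y → (a : G ⧸ H) = b → pr (μ x a) = pr (μ y b) := by
    intro x y a b hxy hab
    obtain ⟨h, hh, rfl⟩ := (hpr.fibers x y).1 hxy
    have hk := QuotientGroup.eq.1 hab
    refine (hpr.fibers _ _).2 ⟨h * (a⁻¹ * b), H.mul_mem hh hk, ?_⟩
    rw [← hμ.mul, ← hμ.mul, ← mul_assoc a h, Subgroup.mem_center_iff.1 (hH hh) a]
    congr 1
    group
  have hsurj := hpr.isQuotientMap.surjective
  refine ⟨fun p q => pr (μ (Function.surjInv hsurj p) q.out), fun x a => ?_⟩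
  exact hwd _ _ _ _ (Function.surjInv_eq hsurj _) (QuotientGroup.out_eq' _)

end IsOrbitQuotient

end Quotient

/-! ### Descent of smoothness along local diffeomorphisms -/

theorem contMDiff_of_comp_isLocalDiffeomorph {𝕜 : Type*} [NontriviallyNormedField 𝕜]
    {E₁ E₂ E₃ H₁ H₂ H₃ A B C : Type*}
    [NormedAddCommGroup E₁] [NormedSpace 𝕜 E₁] [TopologicalSpace H₁]
    [NormedAddCommGroup E₂] [NormedSpace 𝕜 E₂] [TopologicalSpace H₂]
    [NormedAddCommGroup E₃] [NormedSpace 𝕜 E₃] [TopologicalSpace H₃]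
    {I₁ : ModelWithCorners 𝕜 E₁ H₁} {I₂ : ModelWithCorners 𝕜 E₂ H₂} {I₃ : ModelWithCorners 𝕜 E₃ H₃}
    [TopologicalSpace A] [ChartedSpace H₁ A] [TopologicalSpace B] [ChartedSpace H₂ B]
    [TopologicalSpace C] [ChartedSpace H₃ C] {k : WithTop ℕ∞} {p : A → B} {f : B → C}
    (hp : IsLocalDiffeomorph I₁ I₂ k p) (hs : Function.Surjective p)
    (hf : ContMDiff I₁ I₃ k (f ∘ p)) : ContMDiff I₂ I₃ k f := by
  intro b
  obtain ⟨a, rfl⟩ := hs b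
  have h := (hf _).comp (p a) (hp a).localInverse_contMDiffAt
  refine h.congr_of_eventuallyEq ?_
  filter_upwards [(hp a).localInverse_eventuallyEq_right] with y hy
  exact congrArg f hy.symm

theorem IsLocalDiffeomorph.prodMap {𝕜 : Type*} [NontriviallyNormedField 𝕜]
    {E₁ E₂ E₃ E₄ H₁ H₂ H₃ H₄ A B C D : Type*}
    [NormedAddCommGroup E₁] [NormedSpace 𝕜 E₁] [TopologicalSpace H₁]
    [NormedAddCommGroup E₂] [NormedSpace 𝕜 E₂] [TopologicalSpace H₂]
    [NormedAddCommGroup E₃] [NormedSpace 𝕜 E₃] [TopologicalSpace H₃]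
    [NormedAddCommGroup E₄] [NormedSpace 𝕜 E₄] [TopologicalSpace H₄]
    {I₁ : ModelWithCorners 𝕜 E₁ H₁} {I₂ : ModelWithCorners 𝕜 E₂ H₂}
    {I₃ : ModelWithCorners 𝕜 E₃ H₃} {I₄ : ModelWithCorners 𝕜 E₄ H₄}
    [TopologicalSpace A] [ChartedSpace H₁ A] [TopologicalSpace B] [ChartedSpace H₂ B]
    [TopologicalSpace C] [ChartedSpace H₃ C] [TopologicalSpace D] [ChartedSpace H₄ D]
    {k : WithTop ℕ∞} {p : A → B} {q : C → D}
    (hp : IsLocalDiffeomorph I₁ I₂ k p) (hq : IsLocalDiffeomorph I₃ I₄ k q) :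
    IsLocalDiffeomorph (I₁.prod I₃) (I₂.prod I₄) k (Prod.map p q) := by
  rintro ⟨a, c⟩
  obtain ⟨Φ, ha, hΦ⟩ := hp a
  obtain ⟨Ψ, hc, hΨ⟩ := hq c
  exact ⟨{ toPartialEquiv := Φ.toPartialEquiv.prod Ψ.toPartialEquiv
           open_source := Φ.open_source.prod Ψ.open_source
           open_target := Φ.open_target.prod Ψ.open_target
           contMDiffOn_toFun := Φ.contMDiffOn_toFun.prodMap Ψ.contMDiffOn_toFun
           contMDiffOn_invFun := Φ.contMDiffOn_invFun.prodMap Ψ.contMDiffOn_invFun },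
    ⟨ha, hc⟩, fun z hz => Prod.ext (hΦ hz.1) (hΨ hz.2)⟩

/-! ### Centrality, fixed points and the induced action -/

theorem theorem5 {m n q : ℕ}
    -- a simply connected smooth manifold `M`
    {M : Type*} [TopologicalSpace M] [T2Space M] [SecondCountableTopology M]
    [ChartedSpace (EuclideanSpace ℝ (Fin m)) M] [IsManifold (𝓡 m) ∞ M] [SimplyConnectedSpace M]
    -- the Lie algebra generated by vector fields `X₁, …, X_q`, with the standing conditions
    (X : Fin q → VecField m M)
    (hX : IsCompleteHormander (LieSubalgebra.lieSpan ℝ (VecField m M) (Set.range X)))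
    -- the connected and simply connected Lie group `G` with this Lie algebra
    {G : Type*} [TopologicalSpace G] [T2Space G] [SecondCountableTopology G]
    [ChartedSpace (EuclideanSpace ℝ (Fin n)) G] [Group G] [LieGroup (𝓡 n) ∞ G]
    [SimplyConnectedSpace G]
    (L : GroupLieAlgebra (𝓡 n) G ≃ₗ⁅ℝ⁆ LieSubalgebra.lieSpan ℝ (VecField m M) (Set.range X))
    -- the right action of `G` on `M` with infinitesimal generator `L`
    (μ : M → G → M) (hμ : IsActionGeneratedBy L μ)
    -- a discrete subgroup whose action preserves every vector field of the Lie algebra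
    (H : Subgroup G) [DiscreteTopology H]
    (hH : ∀ h ∈ H, ∀ Y ∈ LieSubalgebra.lieSpan ℝ (VecField m M) (Set.range X), ∀ x : M,
      mfderiv (𝓡 m) (𝓡 m) (fun y => μ y h) x (Y x) = Y (μ x h)) :
    -- `H` is central
    H ≤ Subgroup.center G ∧
    -- the elements acting trivially on `M` form a discrete central subgroup
    (∀ c : G, (∀ x, μ x c = x) → c ∈ Subgroup.center G) ∧
    (∀ᶠ c in 𝓝 (1 : G), (∀ x, μ x c = x) → c = 1) ∧
    -- a central element with a fixed point acts trivially
    (∀ c ∈ Subgroup.center G, ∀ x, μ x c = x → ∀ y, μ y c = y) ∧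
    -- the action induces a right action of the group `G/H` on `N = M/H`
    ∃ _ : H.Normal, ∀ (N : Type*) [TopologicalSpace N] (pr : M → N), IsOrbitQuotient μ H pr →
      ∃ ν : N → G ⧸ H → N,
        (∀ x (a : G), ν (pr x) (a : G ⧸ H) = pr (μ x a)) ∧
        IsRightAction ν ∧
        Continuous (fun p : N × (G ⧸ H) => ν p.1 p.2) ∧
        -- and this action is smooth when `N` is a smooth quotient of `M`
        ∀ [ChartedSpace (EuclideanSpace ℝ (Fin m)) N] [IsManifold (𝓡 m) ∞ N],
          IsLocalDiffeomorph (𝓡 m) (𝓡 m) ∞ pr →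
          ContMDiff ((𝓡 m).prod (𝓡 n)) (𝓡 m) ∞ (fun p : N × G => ν p.1 (p.2 : G ⧸ H)) ∧
          ∀ [ChartedSpace (EuclideanSpace ℝ (Fin n)) (G ⧸ H)] [IsManifold (𝓡 n) ∞ (G ⧸ H)],
            IsLocalDiffeomorph (𝓡 n) (𝓡 n) ∞ (QuotientGroup.mk : G → G ⧸ H) →
            ContMDiff ((𝓡 m).prod (𝓡 n)) (𝓡 m) ∞ (fun p : N × (G ⧸ H) => ν p.1 p.2) := by
  have hact := hμ.isRightAction
  have hcen : H ≤ Subgroup.center G := fun h hh => hμ.mem_center_of_preserves (hH h hh)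
  refine ⟨hcen, fun c hc => hμ.mem_center_of_acts_trivially hc,
    hμ.eventually_eq_one_of_acts_trivially,
    fun c hc x hx => hact.apply_eq_of_mem_center (hμ.exists_apply_eq hX) hc hx, ?_⟩
  have hn : H.Normal := ⟨fun h hh a => by
    rwa [Subgroup.mem_center_iff.1 (hcen hh) a, mul_inv_cancel_right]⟩
  refine ⟨hn, fun N _ pr hpr => ?_⟩
  have : IsTopologicalGroup G := topologicalGroup_of_lieGroup (𝓡 n) ∞
  obtain ⟨ν, hν⟩ := hpr.exists_induced hact hcen
  have hsurj := hpr.isQuotientMap.surjective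
  have hprod : IsOpenQuotientMap (Prod.map pr (QuotientGroup.mk : G → G ⧸ H)) :=
    (hpr.isOpenQuotientMap fun a => (hμ.contMDiff_right a).continuous).prodMap
      QuotientGroup.isOpenQuotientMap_mk
  refine ⟨ν, hν, ⟨fun p => ?_, fun p a b => ?_⟩, ?_, fun {_ _} hprl => ⟨?_, fun {_ _} hmk => ?_⟩⟩
  · obtain ⟨x, rfl⟩ := hsurj p
    rw [← QuotientGroup.mk_one, hν, hact.one]
  · obtain ⟨x, rfl⟩ := hsurj p
    obtain ⟨a, rfl⟩ := QuotientGroup.mk_surjective a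
    obtain ⟨b, rfl⟩ := QuotientGroup.mk_surjective b
    rw [← QuotientGroup.mk_mul, hν, hν, hν, hact.mul]
  · refine hprod.continuous_comp_iff.1 ?_
    refine (hpr.isQuotientMap.continuous.comp hμ.contMDiff.continuous).congr fun z => ?_
    exact (hν z.1 z.2).symm
  · refine contMDiff_of_comp_isLocalDiffeomorph
      (hprl.prodMap (Diffeomorph.refl (𝓡 n) G ∞).isLocalDiffeomorph)
      (hsurj.prodMap Function.surjective_id) ?_
    refine (hprl.contMDiff.comp hμ.contMDiff).congr fun z => ?_
    exact hν z.1 z.2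
  · refine contMDiff_of_comp_isLocalDiffeomorph (hprl.prodMap hmk) hprod.surjective ?_
    refine (hprl.contMDiff.comp hμ.contMDiff).congr fun z => ?_
    exact hν z.1 z.2
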